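/- Let $\mathcal H$ be a complex Hilbert space, let $N\ge 2$, and let $A_1,\dots,A_N$ be bounded self-adjoint operators on $\mathcal H$ such that $A_iA_j$ is compact whenever $i\ne j$. Let $E_{A_i}(\cdot)$ denote the projection-valued spectral measure of $A_i$, and for $\varepsilon\ge 0$ put $$\mathcal H_\varepsilon=\bigcap_{i=1}^N E_{A_i}([-\varepsilon,\varepsilon])\,\mathcal H ,\qquad \sum_{i=1}^N \mathrm{Ran}(A_i)=\Big\{\sum_{i=1}^N A_ix_i : x_1,\dots,x_N\in\mathcal H\Big\}.$$ Then $\mathcal H_0=\bigcap_{i=1}^N\mathrm{Ker}(A_i)$, and: 1. $\sum_{i=1}^N\mathrm{Ran}(A_i)$ is closed in $\mathcal H$ if and only if $\mathcal H_\varepsilon=\mathcal H_0$ for some $\varepsilon>0$. 2. If $\mathcal H_\varepsilon\ominus\mathcal H_0=\mathcal H_\varepsilon\cap\mathcal H_0^{\perp}$ is finite dimensional for some $\varepsilon>0$, then $\sum_{i=1}^N\mathrm{Ran}(A_i)$ is closed. 3. If $\sum_{i=1}^N\mathrm{Ran}(A_i)$ is closed, then $\sum_{i=1}^N\mathrm{Ran}(A_i)=\mathcal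 H\ominus\mathcal H_0=\mathcal H_0^{\perp}$. -/

import Mathlib

open MeasureTheory Filter Topology
open scoped InnerProductSpace

section SpectralTheory

variable {H : Type*} [NormedAddCommGroup H] [InnerProductSpace ℂ H] [CompleteSpace H]

/-- For self-adjoint `A` and a vector `x`, the positive functional `f ↦ ⟪x, f(A) x⟫` is
integration against a finite Borel measure. -/
theorem exists_scalarSpectralMeasure (A : H →L[ℂ] H) (hA : IsSelfAdjoint A) (x : H) :
    ∃ μ : Measure ℝ, IsFiniteMeasure μ ∧ ∀ f : ℝ → ℝ, Continuous f →
      ⟪x, cfc f A x⟫_ℂ = ((∫ t, f t ∂μ : ℝ) : ℂ) := by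
  let Φ : C(spectrum ℝ A, ℝ) →⋆ₐ[ℝ] (H →L[ℂ] H) := cfcHom (R := ℝ) hA
  let Λ₀ : CompactlySupportedContinuousMap (spectrum ℝ A) ℝ →ₗ[ℝ] ℝ :=
    { toFun := fun f => (⟪x, Φ f.toContinuousMap x⟫_ℂ).re
      map_add' := by
        intro f g
        have : (f + g).toContinuousMap = f.toContinuousMap + g.toContinuousMap := rfl
        simp [this]
      map_smul' := by
        intro c f
        have : (c • f).toContinuousMap = c • f.toContinuousMap := rfl
        simp [this, inner_smul_right_eq_smul] }
  let Λ := PositiveLinearMap.mk₀ Λ₀ (by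
    intro f hf
    have h1 : (0 : C(spectrum ℝ A, ℝ)) ≤ f.toContinuousMap := fun t => hf t
    have h2 : 0 ≤ Φ f.toContinuousMap := by
      simpa [Φ] using cfcHom_mono hA h1
    rw [ContinuousLinearMap.nonneg_iff_isPositive] at h2
    exact h2.re_inner_nonneg_right x)
  have : CompactSpace (spectrum ℝ A) := isCompact_iff_compactSpace.mp (spectrum.isCompact A)
  refine ⟨(RealRMK.rieszMeasure Λ).map Subtype.val, ?_, ?_⟩
  · infer_instance
  · intro f hf
    rw [integral_map (by fun_prop) (by fun_prop)]
    let g : CompactlySupportedContinuousMap (spectrum ℝ A) ℝ :=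
      ⟨⟨fun t => f t, by fun_prop⟩, HasCompactSupport.of_compactSpace _⟩
    have := RealRMK.integral_rieszMeasure Λ g
    have h3 : cfc f A = Φ g.toContinuousMap := cfc_apply f A hA hf.continuousOn
    have h4 : (∫ t, g t ∂(RealRMK.rieszMeasure Λ)) = (⟪x, cfc f A x⟫_ℂ).re := by
      rw [this, h3]; rfl
    change _ = ((∫ t, g t ∂(RealRMK.rieszMeasure Λ) : ℝ) : ℂ)
    rw [h4]
    have h5 : IsSelfAdjoint (cfc f A) := cfc_predicate f A
    have h6 := (ContinuousLinearMap.isSelfAdjoint_iff_isSymmetric.mp h5)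
    have := h6.im_inner_self_apply x
    apply Complex.ext
    · simp
    · rw [Complex.ofReal_im]
      have h7 := h6 x x
      rw [← inner_conj_symm] at h7
      exact Complex.conj_eq_iff_im.mp h7

theorem norm_cfc_sq (A : H →L[ℂ] H) (μ : Measure ℝ) (x : H)
    (hμ : ∀ f : ℝ → ℝ, Continuous f → ⟪x, cfc f A x⟫_ℂ = ((∫ t, f t ∂μ : ℝ) : ℂ))
    (hA : IsSelfAdjoint A) (f : ℝ → ℝ) (hf : Continuous f) :
    ‖cfc f A x‖ ^ 2 = ∫ t, f t ^ 2 ∂μ := by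
  have h5 : IsSelfAdjoint (cfc f A) := cfc_predicate f A
  have h6 := (ContinuousLinearMap.isSelfAdjoint_iff_isSymmetric.mp h5)
  have h1 := hμ (fun t => f t * f t) (by fun_prop)
  rw [cfc_mul f f A hf.continuousOn hf.continuousOn] at h1
  have h2 : ⟪x, (cfc f A * cfc f A) x⟫_ℂ = ⟪cfc f A x, cfc f A x⟫_ℂ := (h6 x (cfc f A x)).symm
  rw [h2, inner_self_eq_norm_sq_to_K] at h1
  simp only [pow_two]
  rw [← pow_two]
  apply Complex.ofReal_injective
  rw [← h1]
  push_cast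
  rfl

theorem exists_projection_of_seq (μ : H → Measure ℝ) [∀ x, IsFiniteMeasure (μ x)]
    (T : ℕ → H →L[ℂ] H) (f : ℕ → ℝ → ℝ) (S : Set ℝ) (hS : MeasurableSet S)
    (hT : ∀ n, IsSelfAdjoint (T n)) (hfm : ∀ n, Measurable (f n)) (hb : ∀ n t, |f n t| ≤ 1)
    (hlim : ∀ t, Tendsto (fun n => f n t) atTop (𝓝 (S.indicator 1 t)))
    (h1 : ∀ n x, (⟪x, T n x⟫_ℂ).re = ∫ t, f n t ∂(μ x))
    (h2 : ∀ n m x, ‖T n x - T m x‖ ^ 2 = ∫ t, (f n t - f m t) ^ 2 ∂(μ x))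
    (h3 : ∀ n x, ‖T n x‖ ^ 2 = ∫ t, (f n t) ^ 2 ∂(μ x)) :
    ∃ P : H →L[ℂ] H, IsStarProjection P ∧ ∀ x, ‖P x‖ ^ 2 = (μ x).real S := by
  have hcau : ∀ x, CauchySeq (fun n => T n x) := by
    intro x
    rw [cauchySeq_iff_tendsto_dist_atTop_0]
    have key : Tendsto (fun p : ℕ × ℕ => ∫ t, (f p.1 t - f p.2 t) ^ 2 ∂(μ x)) atTop
        (𝓝 (∫ _t, (0 : ℝ) ∂(μ x))) := by
      apply tendsto_integral_filter_of_dominated_convergence (fun _ => (4 : ℝ))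
      · filter_upwards with p
        exact (((hfm p.1).sub (hfm p.2)).pow_const 2).aestronglyMeasurable
      · filter_upwards with p
        filter_upwards with t
        have a := abs_le.mp (hb p.1 t)
        have b := abs_le.mp (hb p.2 t)
        rw [Real.norm_eq_abs, abs_of_nonneg (sq_nonneg _)]
        nlinarith
      · exact integrable_const _
      · filter_upwards with t
        rw [← prod_atTop_atTop_eq]
        have a := ((hlim t).comp tendsto_fst).sub ((hlim t).comp (tendsto_snd (f := atTop (α := ℕ)) (g := atTop (α := ℕ))))
        simpa using a.pow 2
    have k2 := (Real.continuous_sqrt.tendsto _).comp key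
    simp only [integral_zero, Real.sqrt_zero] at k2
    refine k2.congr fun p => ?_
    simp only [Function.comp]
    rw [← h2, Real.sqrt_sq (norm_nonneg _), dist_eq_norm]
  choose L hL using fun x => cauchySeq_tendsto_of_complete (hcau x)
  let P : H →L[ℂ] H := continuousLinearMapOfTendsto T (f := L) (tendsto_pi_nhds.mpr hL)
  have hP : ∀ x, Tendsto (fun n => T n x) atTop (𝓝 (P x)) := hL
  have hsymm : P.toLinearMap.IsSymmetric := by
    intro x y
    have a := (hP x).inner (tendsto_const_nhds (x := y)) (𝕜 := ℂ)
    have b := (tendsto_const_nhds (x := x)).inner (hP y) (𝕜 := ℂ)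
    refine tendsto_nhds_unique a (b.congr fun n => ?_)
    exact (ContinuousLinearMap.isSelfAdjoint_iff_isSymmetric.mp (hT n) x y).symm
  have ind : ∀ x, ∫ t, S.indicator (1 : ℝ → ℝ) t ∂(μ x) = (μ x).real S := by
    intro x; rw [integral_indicator_one hS]
  have e1 : ∀ x, (⟪x, P x⟫_ℂ).re = (μ x).real S := by
    intro x
    have a := (Complex.continuous_re.tendsto _).comp
      ((tendsto_const_nhds (x := x)).inner (hP x) (𝕜 := ℂ))
    refine tendsto_nhds_unique a ?_
    rw [← ind]
    have b : Tendsto (fun n => ∫ t, f n t ∂(μ x)) atTop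
        (𝓝 (∫ t, S.indicator (1 : ℝ → ℝ) t ∂(μ x))) := by
      apply tendsto_integral_of_dominated_convergence (fun _ => (1 : ℝ))
      · exact fun n => (hfm n).aestronglyMeasurable
      · exact integrable_const _
      · intro n; filter_upwards with t; exact hb n t
      · filter_upwards with t; exact hlim t
    exact b.congr fun n => (h1 n x).symm
  have e2 : ∀ x, ‖P x‖ ^ 2 = (μ x).real S := by
    intro x
    refine tendsto_nhds_unique ((hP x).norm.pow 2) ?_
    rw [← ind]
    have b : Tendsto (fun n => ∫ t, f n t ^ 2 ∂(μ x)) atTop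
        (𝓝 (∫ t, S.indicator (1 : ℝ → ℝ) t ∂(μ x))) := by
      apply tendsto_integral_of_dominated_convergence (fun _ => (1 : ℝ))
      · exact fun n => ((hfm n).pow_const 2).aestronglyMeasurable
      · exact integrable_const _
      · intro n; filter_upwards with t
        rw [norm_pow]
        exact pow_le_one₀ (norm_nonneg _) (hb n t)
      · filter_upwards with t
        have : S.indicator (1 : ℝ → ℝ) t = S.indicator (1 : ℝ → ℝ) t ^ 2 := by
          by_cases h : t ∈ S <;> simp [h]
        rw [this]
        exact (hlim t).pow 2
    exact b.congr fun n => (h3 n x).symm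
  refine ⟨P, ⟨?_, ContinuousLinearMap.isSelfAdjoint_iff_isSymmetric.mpr hsymm⟩, e2⟩
  have : ((P * P : H →L[ℂ] H) : H →ₗ[ℂ] H) = (P : H →ₗ[ℂ] H) := by
    rw [← ext_inner_map]
    intro x
    have a : ⟪P (P x), x⟫_ℂ = ⟪P x, P x⟫_ℂ := hsymm (P x) x
    have b : ⟪P x, x⟫_ℂ = ⟪x, P x⟫_ℂ := hsymm x x
    have c : (⟪x, P x⟫_ℂ).im = 0 := by
      rw [← inner_conj_symm] at b
      exact Complex.conj_eq_iff_im.mp b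
    change ⟪P (P x), x⟫_ℂ = ⟪P x, x⟫_ℂ
    rw [a, b, inner_self_eq_norm_sq_to_K]
    apply Complex.ext
    · rw [e1, ← e2 x]; norm_cast
    · rw [c]; norm_cast
  exact ContinuousLinearMap.coe_injective this

theorem IsStarProjection.inner_self_apply {P : H →L[ℂ] H} (hP : IsStarProjection P) (x : H) :
    ⟪x, P x⟫_ℂ = ((‖P x‖ ^ 2 : ℝ) : ℂ) := by
  have hs := ContinuousLinearMap.isSelfAdjoint_iff_isSymmetric.mp hP.isSelfAdjoint
  have h1 : P (P x) = P x := congrArg (fun T : H →L[ℂ] H => T x) hP.isIdempotentElem.eq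
  have h2 : ⟪P x, P x⟫_ℂ = ⟪x, P (P x)⟫_ℂ := hs x (P x)
  rw [h1, inner_self_eq_norm_sq_to_K] at h2
  rw [← h2]; push_cast; rfl

theorem IsStarProjection.eq_of_norm_sq {P Q : H →L[ℂ] H} (hP : IsStarProjection P)
    (hQ : IsStarProjection Q) (h : ∀ x, ‖P x‖ ^ 2 = ‖Q x‖ ^ 2) : P = Q := by
  have : (P : H →ₗ[ℂ] H) = (Q : H →ₗ[ℂ] H) := by
    rw [← ext_inner_map]
    intro x
    have a : ⟪P x, x⟫_ℂ = ⟪x, P x⟫_ℂ :=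
      ContinuousLinearMap.isSelfAdjoint_iff_isSymmetric.mp hP.isSelfAdjoint x x
    have b : ⟪Q x, x⟫_ℂ = ⟪x, Q x⟫_ℂ :=
      ContinuousLinearMap.isSelfAdjoint_iff_isSymmetric.mp hQ.isSelfAdjoint x x
    change ⟪P x, x⟫_ℂ = ⟪Q x, x⟫_ℂ
    rw [a, b, hP.inner_self_apply, hQ.inner_self_apply, h]
  exact ContinuousLinearMap.coe_injective this

theorem IsStarProjection.mul_eq_zero_of_norm_sq {P Q : H →L[ℂ] H} (hP : IsStarProjection P)
    (h : ∀ x, ‖P x‖ ^ 2 + ‖Q x‖ ^ 2 ≤ ‖x‖ ^ 2) (x : H) : Q (P x) = 0 := by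
  have h1 : P (P x) = P x := congrArg (fun T : H →L[ℂ] H => T x) hP.isIdempotentElem.eq
  have h2 := h (P x)
  rw [h1] at h2
  have h3 : ‖Q (P x)‖ ^ 2 ≤ 0 := by linarith
  have h4 : ‖Q (P x)‖ ^ 2 = 0 := le_antisymm h3 (sq_nonneg _)
  simpa using h4

theorem norm_sq_sum_projections {P : ℕ → H →L[ℂ] H} (hP : ∀ n, IsStarProjection (P n))
    (ho : ∀ m n, m ≠ n → ∀ x, P m (P n x) = 0) (s : Finset ℕ) (x : H) :
    ‖∑ n ∈ s, P n x‖ ^ 2 = ∑ n ∈ s, ‖P n x‖ ^ 2 := by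
  apply Complex.ofReal_injective
  have h0 : ((‖∑ n ∈ s, P n x‖ ^ 2 : ℝ) : ℂ) = ⟪∑ n ∈ s, P n x, ∑ n ∈ s, P n x⟫_ℂ := by
    rw [inner_self_eq_norm_sq_to_K]; push_cast; rfl
  rw [h0, sum_inner]
  push_cast
  refine Finset.sum_congr rfl fun m hm => ?_
  rw [inner_sum, Finset.sum_eq_single m]
  · rw [inner_self_eq_norm_sq_to_K]; rfl
  · intro n _ hn
    have hs := ContinuousLinearMap.isSelfAdjoint_iff_isSymmetric.mp (hP m).isSelfAdjoint
    have : ⟪P m x, P n x⟫_ℂ = ⟪x, P m (P n x)⟫_ℂ := hs x (P n x)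
    rw [this, ho m n hn.symm, inner_zero_right]
  · intro h; exact absurd hm h

theorem exists_projection (A : H →L[ℂ] H) (hA : IsSelfAdjoint A) (μ : H → Measure ℝ)
    [∀ x, IsFiniteMeasure (μ x)]
    (hμ : ∀ x, ∀ f : ℝ → ℝ, Continuous f → ⟪x, cfc f A x⟫_ℂ = ((∫ t, f t ∂(μ x) : ℝ) : ℂ))
    (S : Set ℝ) (hS : MeasurableSet S) :
    ∃ P : H →L[ℂ] H, IsStarProjection P ∧ ∀ x, ‖P x‖ ^ 2 = (μ x).real S := by
  have huniv : ∀ x, (μ x).real Set.univ = ‖x‖ ^ 2 := by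
    intro x
    have h := norm_cfc_sq A (μ x) x (hμ x) hA (fun _ => 1) continuous_const
    rw [cfc_const_one ℝ A] at h
    simpa using h.symm
  induction S, hS using MeasurableSpace.induction_on_inter
      (borel_eq_generateFrom_isClosed (α := ℝ) ▸ BorelSpace.measurable_eq (α := ℝ))
      isPiSystem_isClosed with
  | empty => exact ⟨0, IsStarProjection.zero _, by simp⟩
  | basic F hF =>
    have hF : IsClosed F := hF
    let δ : ℕ → ℝ := fun n => 1 / ((n : ℝ) + 1)
    have hδ : ∀ n, 0 < δ n := fun n => Nat.one_div_pos_of_nat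
    let f : ℕ → ℝ → ℝ := fun n t => (thickenedIndicator (hδ n) F t : ℝ)
    have hf : ∀ n, Continuous (f n) := fun n =>
      NNReal.continuous_coe.comp (thickenedIndicator (hδ n) F).continuous
    refine exists_projection_of_seq μ (fun n => cfc (f n) A) f F hF.measurableSet
      (fun n => cfc_predicate _ A) (fun n => (hf n).measurable) ?_ ?_ ?_ ?_ ?_
    · intro n t
      rw [abs_of_nonneg (NNReal.coe_nonneg _)]
      exact_mod_cast thickenedIndicator_le_one (hδ n) F t
    · intro t
      have h := tendsto_pi_nhds.mp (thickenedIndicator_tendsto_indicator_closure hδ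
        tendsto_one_div_add_atTop_nhds_zero_nat F) t
      rw [hF.closure_eq] at h
      have h' := (NNReal.continuous_coe.tendsto _).comp h
      have e : ((F.indicator (fun _ => (1 : NNReal)) t : NNReal) : ℝ) = F.indicator 1 t := by
        by_cases ht : t ∈ F <;> simp [ht]
      rw [e] at h'
      exact h'
    · intro n x
      rw [hμ x _ (hf n), Complex.ofReal_re]
    · intro n m x
      rw [← norm_cfc_sq A (μ x) x (hμ x) hA (fun t => f n t - f m t) ((hf n).sub (hf m)),
        cfc_sub (f n) (f m) A (hf n).continuousOn (hf m).continuousOn]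
      rfl
    · intro n x
      exact norm_cfc_sq A (μ x) x (hμ x) hA (f n) (hf n)
  | compl S hS ih =>
    obtain ⟨P, hP, h⟩ := ih
    refine ⟨1 - P, hP.one_sub, fun x => ?_⟩
    have h1 := hP.one_sub.inner_self_apply x
    have h2 : ⟪x, (1 - P) x⟫_ℂ = ((‖x‖ ^ 2 - ‖P x‖ ^ 2 : ℝ) : ℂ) := by
      have : (1 - P) x = x - P x := rfl
      rw [this, inner_sub_right, hP.inner_self_apply, inner_self_eq_norm_sq_to_K]
      push_cast; rfl
    rw [h2] at h1
    have h3 := Complex.ofReal_injective h1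
    rw [← h3, h, measureReal_compl hS, huniv]
  | iUnion s hd hs ih =>
    choose P hP h using ih
    have ho : ∀ m n, m ≠ n → ∀ x, P m (P n x) = 0 := by
      intro m n hmn x
      refine (hP n).mul_eq_zero_of_norm_sq (fun y => ?_) x
      rw [h, h, ← huniv, ← measureReal_union (hd hmn.symm) (hs m)]
      exact measureReal_mono (Set.subset_univ _)
    have hind : ∀ F : Finset ℕ, ∀ t, (∑ n ∈ F, (s n).indicator (1 : ℝ → ℝ) t)
        = (⋃ n ∈ F, s n).indicator (1 : ℝ → ℝ) t := by
      intro F t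
      rw [Finset.indicator_biUnion_apply F s (fun i _ j _ hij => hd hij)]
    have hreal : ∀ F : Finset ℕ, ∀ x, (μ x).real (⋃ n ∈ F, s n) = ∑ n ∈ F, ‖P n x‖ ^ 2 := by
      intro F x
      rw [measureReal_biUnion_finset (fun i _ j _ hij => hd hij) (fun n _ => hs n)]
      exact Finset.sum_congr rfl fun n _ => (h n x).symm
    have hm : ∀ F : Finset ℕ, MeasurableSet (⋃ n ∈ F, s n) :=
      fun F => Finset.measurableSet_biUnion F fun n _ => hs n
    have hint : ∀ F : Finset ℕ, ∀ x, ∫ t, (∑ n ∈ F, (s n).indicator (1 : ℝ → ℝ) t) ∂(μ x)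
        = ∑ n ∈ F, ‖P n x‖ ^ 2 := by
      intro F x
      simp_rw [hind F]
      rw [integral_indicator_one (hm F), hreal]
    have hint2 : ∀ F : Finset ℕ, ∀ x,
        ∫ t, (∑ n ∈ F, (s n).indicator (1 : ℝ → ℝ) t) ^ 2 ∂(μ x) = ∑ n ∈ F, ‖P n x‖ ^ 2 := by
      intro F x
      rw [← hint]
      refine integral_congr_ae (Eventually.of_forall fun t => ?_)
      simp only [hind F]
      by_cases ht : t ∈ ⋃ n ∈ F, s n <;> simp only [ht, Set.indicator_of_mem,
        Set.indicator_of_notMem, not_false_eq_true, Pi.one_apply] <;> norm_num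
    have hle : ∀ N M, N ≤ M → ∀ x, ‖(∑ n ∈ Finset.range M, P n) x - (∑ n ∈ Finset.range N, P n) x‖ ^ 2
        = ∫ t, ((∑ n ∈ Finset.range M, (s n).indicator (1 : ℝ → ℝ) t)
          - ∑ n ∈ Finset.range N, (s n).indicator (1 : ℝ → ℝ) t) ^ 2 ∂(μ x) := by
      intro N M hNM x
      simp only [_root_.sum_apply, ← Finset.sum_Ico_eq_sub _ hNM]
      rw [norm_sq_sum_projections hP ho, hint2]
    refine exists_projection_of_seq μ (fun N => ∑ n ∈ Finset.range N, P n)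
      (fun N t => ∑ n ∈ Finset.range N, (s n).indicator (1 : ℝ → ℝ) t) (⋃ n, s n)
      (MeasurableSet.iUnion hs) (fun N => ?_) (fun N => ?_) ?_ ?_ ?_ ?_ ?_
    · exact isSelfAdjoint_sum _ fun n _ => (hP n).isSelfAdjoint
    · exact Finset.measurable_sum _ fun n _ => measurable_one.indicator (hs n)
    · intro N t
      simp only [hind]
      by_cases ht : t ∈ ⋃ n ∈ Finset.range N, s n <;> simp only [ht, Set.indicator_of_mem,
        Set.indicator_of_notMem, not_false_eq_true, Pi.one_apply] <;> norm_num
    · intro t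
      simp only [hind]
      exact ((tendsto_indicator_biUnion_finset s (1 : ℝ → ℝ) t).mono_right
        (pure_le_nhds _)).comp tendsto_finset_range
    · intro N x
      simp only [_root_.sum_apply]
      rw [hint, inner_sum, Complex.re_sum]
      refine Finset.sum_congr rfl fun n _ => ?_
      rw [(hP n).inner_self_apply, Complex.ofReal_re]
    · intro N M x
      rcases le_total M N with hNM | hNM
      · exact hle M N hNM x
      · rw [norm_sub_rev, hle N M hNM x]
        congr 1; ext t; ring
    · intro N x
      simp only [_root_.sum_apply]
      rw [hint2, norm_sq_sum_projections hP ho]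

/-- A projection-valued measure on the Borel sets of `ℝ`: every Borel set is sent to an orthogonal
projection, `ℝ` is sent to the identity, and the assignment is countably additive in the strong
operator topology. The value on non-Borel sets is irrelevant. -/
structure ProjectionValuedMeasure (H : Type*) [NormedAddCommGroup H] [InnerProductSpace ℂ H]
    [CompleteSpace H] where
  proj : Set ℝ → H →L[ℂ] H
  isStarProjection : ∀ S, MeasurableSet S → IsStarProjection (proj S)
  proj_univ : proj Set.univ = 1
  hasSum_proj : ∀ s : ℕ → Set ℝ, (∀ n, MeasurableSet (s n)) → Pairwise (Function.onFun Disjoint s) →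
    ∀ x, HasSum (fun n => proj (s n) x) (proj (⋃ n, s n) x)

namespace ProjectionValuedMeasure

theorem proj_empty (E : ProjectionValuedMeasure H) : E.proj ∅ = 0 := by
  ext x
  have h := E.hasSum_proj (fun _ => ∅) (fun _ => MeasurableSet.empty)
    (fun _ _ _ => disjoint_bot_left) x
  simpa using h.summable.tendsto_atTop_zero

theorem hasSum_norm_sq (E : ProjectionValuedMeasure H) (s : ℕ → Set ℝ)
    (hs : ∀ n, MeasurableSet (s n)) (hd : Pairwise (Function.onFun Disjoint s)) (x : H) :
    HasSum (fun n => ‖E.proj (s n) x‖ ^ 2) (‖E.proj (⋃ n, s n) x‖ ^ 2) := by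
  have h := Complex.hasSum_re ((E.hasSum_proj s hs hd x).mapL (innerSL ℂ x))
  simpa only [innerSL_apply_apply, (E.isStarProjection _ (hs _)).inner_self_apply,
    (E.isStarProjection _ (MeasurableSet.iUnion hs)).inner_self_apply, Complex.ofReal_re] using h

/-- The finite Borel measure `S ↦ ⟪x, E(S) x⟫ = ‖E(S) x‖²`. -/
noncomputable def diagMeasure (E : ProjectionValuedMeasure H) (x : H) : Measure ℝ :=
  Measure.ofMeasurable (fun S _ => ENNReal.ofReal (‖E.proj S x‖ ^ 2))
    (by simp [E.proj_empty])
    (fun s hs hd => by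
      have h := E.hasSum_norm_sq s hs hd x
      rw [← h.tsum_eq, ENNReal.ofReal_tsum_of_nonneg (fun _ => sq_nonneg _) h.summable])

theorem diagMeasure_apply (E : ProjectionValuedMeasure H) (x : H) {S : Set ℝ}
    (hS : MeasurableSet S) : E.diagMeasure x S = ENNReal.ofReal (‖E.proj S x‖ ^ 2) :=
  Measure.ofMeasurable_apply S hS

instance (E : ProjectionValuedMeasure H) (x : H) : IsFiniteMeasure (E.diagMeasure x) :=
  ⟨by rw [E.diagMeasure_apply x MeasurableSet.univ]; exact ENNReal.ofReal_lt_top⟩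

end ProjectionValuedMeasure

/-- `E` is the projection-valued spectral measure of `A`: `f(A) = ∫ f dE` weakly, for every
continuous `f`, where `f(A)` is the continuous functional calculus. The case `f(t) = t` is
`A = ∫ t dE(t)`. -/
def IsSpectralMeasure (A : H →L[ℂ] H) (E : ProjectionValuedMeasure H) : Prop :=
  ∀ f : ℝ → ℝ, Continuous f → ∀ x : H,
    ⟪x, cfc f A x⟫_ℂ = ((∫ t, f t ∂(E.diagMeasure x) : ℝ) : ℂ)

/-- The spectral measure is unique on Borel sets. -/
theorem IsSpectralMeasure.unique {A : H →L[ℂ] H} {E F : ProjectionValuedMeasure H}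
    (hE : IsSpectralMeasure A E) (hF : IsSpectralMeasure A F) {S : Set ℝ}
    (hS : MeasurableSet S) : E.proj S = F.proj S := by
  refine (E.isStarProjection S hS).eq_of_norm_sq (F.isStarProjection S hS) fun x => ?_
  have h : E.diagMeasure x = F.diagMeasure x := by
    apply ext_of_forall_integral_eq_of_IsFiniteMeasure
    intro f
    exact Complex.ofReal_injective ((hE f f.continuous x).symm.trans (hF f f.continuous x))
  have h2 := congrArg (fun m => m S) h
  simp only [E.diagMeasure_apply x hS, F.diagMeasure_apply x hS] at h2
  exact (ENNReal.ofReal_eq_ofReal_iff (sq_nonneg _) (sq_nonneg _)).mp h2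

/-- Spectral theorem: every bounded self-adjoint operator has a spectral measure. -/
theorem exists_isSpectralMeasure (A : H →L[ℂ] H) (hA : IsSelfAdjoint A) :
    ∃ E : ProjectionValuedMeasure H, IsSpectralMeasure A E := by
  classical
  choose μ hfin hμ using exists_scalarSpectralMeasure A hA
  have huniv : ∀ x, (μ x).real Set.univ = ‖x‖ ^ 2 := by
    intro x
    have h := norm_cfc_sq A (μ x) x (hμ x) hA (fun _ => 1) continuous_const
    rw [cfc_const_one ℝ A] at h
    simpa using h.symm
  choose P hP hn using exists_projection A hA μ hμ
  let Q : Set ℝ → H →L[ℂ] H := fun S => if hS : MeasurableSet S then P S hS else 0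
  have hQ : ∀ S, MeasurableSet S → IsStarProjection (Q S) := fun S hS => by
    simp only [Q, dif_pos hS]; exact hP S hS
  have hQn : ∀ S, MeasurableSet S → ∀ x, ‖Q S x‖ ^ 2 = (μ x).real S := fun S hS x => by
    simp only [Q, dif_pos hS]; exact hn S hS x
  have hadd : ∀ S T, MeasurableSet S → MeasurableSet T → Disjoint S T →
      Q (S ∪ T) = Q S + Q T := by
    intro S T hS hT hd
    have : ((Q (S ∪ T) : H →L[ℂ] H) : H →ₗ[ℂ] H) = ((Q S + Q T : H →L[ℂ] H) : H →ₗ[ℂ] H) := by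
      rw [← ext_inner_map]
      intro x
      have e : ∀ U, MeasurableSet U → ⟪Q U x, x⟫_ℂ = (((μ x).real U : ℝ) : ℂ) := fun U hU => by
        have a : ⟪Q U x, x⟫_ℂ = ⟪x, Q U x⟫_ℂ :=
          ContinuousLinearMap.isSelfAdjoint_iff_isSymmetric.mp (hQ U hU).isSelfAdjoint x x
        rw [a, (hQ U hU).inner_self_apply, hQn U hU]
      change ⟪Q (S ∪ T) x, x⟫_ℂ = ⟪Q S x + Q T x, x⟫_ℂ
      rw [inner_add_left, e _ hS, e _ hT, e _ (hS.union hT), measureReal_union hd hT]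
      push_cast; rfl
    exact ContinuousLinearMap.coe_injective this
  have hempty : Q ∅ = 0 := by
    ext x
    have := hQn ∅ MeasurableSet.empty x
    simpa using this
  have hsum : ∀ s : ℕ → Set ℝ, (∀ n, MeasurableSet (s n)) →
      Pairwise (Function.onFun Disjoint s) → ∀ F : Finset ℕ,
      Q (⋃ n ∈ F, s n) = ∑ n ∈ F, Q (s n) := by
    intro s hs hd F
    induction F using Finset.induction_on with
    | empty => simpa using hempty
    | insert a F ha ih =>
      rw [Finset.set_biUnion_insert, hadd _ _ (hs a) (Finset.measurableSet_biUnion F fun n _ => hs n),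
        ih, Finset.sum_insert ha]
      rw [Set.disjoint_iUnion₂_right]
      intro i hi
      exact hd (fun h => ha (h ▸ hi))
  let E : ProjectionValuedMeasure H :=
    { proj := Q
      isStarProjection := hQ
      proj_univ := by
        refine (hQ _ MeasurableSet.univ).eq_of_norm_sq (IsStarProjection.one _) fun x => ?_
        rw [hQn _ MeasurableSet.univ, huniv]; rfl
      hasSum_proj := by
        intro s hs hd x
        have hU := MeasurableSet.iUnion hs
        have key : ∀ F : Finset ℕ, ‖(∑ n ∈ F, Q (s n) x) - Q (⋃ n, s n) x‖ ^ 2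
            = (μ x).real (⋃ n, s n) - ∑ n ∈ F, (μ x).real (s n) := by
          intro F
          have hm : MeasurableSet (⋃ n ∈ F, s n) := Finset.measurableSet_biUnion F fun n _ => hs n
          have hsub : (⋃ n ∈ F, s n) ⊆ ⋃ n, s n :=
            Set.iUnion₂_subset fun n _ => Set.subset_iUnion s n
          have h1 := hadd _ _ hm (hU.diff hm) Set.disjoint_sdiff_right
          rw [Set.union_sdiff_cancel hsub, hsum s hs hd F] at h1
          rw [h1]
          have h2 : (∑ n ∈ F, Q (s n) x) - (∑ n ∈ F, Q (s n) + Q ((⋃ n, s n) \ ⋃ n ∈ F, s n)) x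
              = - Q ((⋃ n, s n) \ ⋃ n ∈ F, s n) x := by
            simp
          rw [h2, norm_neg, hQn _ (hU.diff hm), measureReal_sdiff hsub hm,
            measureReal_biUnion_finset (fun i _ j _ hij => hd hij) (fun n _ => hs n)]
        have hlim : HasSum (fun n => (μ x).real (s n)) ((μ x).real (⋃ n, s n)) := by
          have h0 := measure_iUnion (μ := μ x) hd hs
          have h1 := ENNReal.hasSum_toReal (h0 ▸ measure_ne_top (μ x) (⋃ n, s n))
          rw [← ENNReal.tsum_toReal_eq (fun n => measure_ne_top (μ x) (s n)), ← h0] at h1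
          exact h1
        rw [HasSum, SummationFilter.unconditional_filter, tendsto_iff_norm_sub_tendsto_zero]
        rw [HasSum, SummationFilter.unconditional_filter] at hlim
        have h3 := (tendsto_const_nhds (x := (μ x).real (⋃ n, s n))).sub hlim
        rw [sub_self] at h3
        have h4 := (Real.continuous_sqrt.tendsto _).comp h3
        rw [Real.sqrt_zero] at h4
        refine h4.congr fun F => ?_
        simp only [Function.comp]
        rw [← key F, Real.sqrt_sq (norm_nonneg _)] }
  refine ⟨E, fun f hf x => ?_⟩
  have : E.diagMeasure x = μ x := by
    ext S hS
    rw [E.diagMeasure_apply x hS]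
    change ENNReal.ofReal (‖Q S x‖ ^ 2) = _
    rw [hQn S hS, ofReal_measureReal]
  rw [this, hμ x f hf]

/-- The projection-valued spectral measure `E_A` of a bounded self-adjoint operator `A`. -/
noncomputable def spectralMeasure (A : H →L[ℂ] H) (hA : IsSelfAdjoint A) :
    ProjectionValuedMeasure H :=
  (exists_isSpectralMeasure A hA).choose

theorem isSpectralMeasure_spectralMeasure (A : H →L[ℂ] H) (hA : IsSelfAdjoint A) :
    IsSpectralMeasure A (spectralMeasure A hA) :=
  (exists_isSpectralMeasure A hA).choose_spec

/-- `H_ε(A₁, …, A_N) = ⋂ᵢ E_{Aᵢ}([-ε, ε]) H`. -/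
noncomputable def spectralSubspace {N : ℕ} (A : Fin N → H →L[ℂ] H)
    (hA : ∀ i, IsSelfAdjoint (A i)) (ε : ℝ) : Submodule ℂ H :=
  ⨅ i, ((spectralMeasure (A i) (hA i)).proj (Set.Icc (-ε) ε)).range

/-- The algebraic sum of the ranges, `{∑ᵢ Aᵢ xᵢ | xᵢ ∈ H}`. -/
def sumRanges {N : ℕ} (A : Fin N → H →L[ℂ] H) : Submodule ℂ H :=
  ⨆ i, (A i).range

end SpectralTheory

/-! ### Operators invertible on the left modulo compacts -/

section ClosedRange

variable {E F : Type*} [NormedAddCommGroup E] [InnerProductSpace ℂ E]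
  [NormedAddCommGroup F] [NormedSpace ℂ F]

/-! Write `R` for the sum of the ranges. Self-adjointness gives `Rᗮ = ⋂ Ker Aᵢ = H₀`, so `R ⊆ H₀ᗮ`,
with equality when `R` is closed.

If `R` is closed, the open mapping theorem writes each `x ∈ R` as `∑ Aᵢ yᵢ` with `‖yᵢ‖ ≤ C‖x‖`. If
`x` also lies in `H_ε`, then `‖Aᵢ x‖ ≤ ε‖x‖`, so `‖x‖² = ∑ ⟪Aᵢ x, yᵢ⟫ ≤ N C ε ‖x‖²`. For small `ε`
this forces `x = 0`, that is `H_ε ∩ H₀ᗮ = 0` (`spectralSubspace_inf_orthogonal_eq_bot`).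

Conversely, let `Pᵢ = 1 - E_{Aᵢ}([-ε, ε])`. Away from `0` the operator `Aᵢ` can be inverted, so `Pᵢ
= Aᵢ Cᵢ = Cᵢ* Aᵢ` and `Pᵢ Pⱼ = Cᵢ* (Aᵢ Aⱼ) Cⱼ` is compact for `i ≠ j`. Projections that are
orthogonal modulo compacts have a closed sum of ranges
(`isClosed_iSup_of_isCompactOperator_starProjection`). That sum has orthogonal complement `H_ε`, so
it equals `H_εᗮ`, and `H_εᗮ ⊆ R ⊆ H₀ᗮ` (`orthogonal_spectralSubspace_le_sumRanges`). If `H_ε ∩ H₀ᗮ`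
is finite dimensional, `R` is a closed subspace plus a finite-dimensional one, hence closed. The
case `H_ε = H₀` is dimension zero. -/

/-- An operator with a left inverse modulo the compact operators is bounded below on the
orthogonal complement of its kernel. -/
theorem exists_bound_orthogonal_ker_of_isCompactOperator (T : E →L[ℂ] F) (S : F →L[ℂ] E)
    (h : IsCompactOperator (S ∘L T - 1 : E →L[ℂ] E)) :
    ∃ c : ℝ, 0 < c ∧ ∀ x ∈ T.kerᗮ, c * ‖x‖ ≤ ‖T x‖ := by
  by_contra! hcon
  have hseq : ∀ n : ℕ, ∃ x ∈ T.kerᗮ, ‖x‖ = 1 ∧ ‖T x‖ ≤ 1 / ((n : ℝ) + 1) := by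
    intro n
    obtain ⟨x, hx, hlt⟩ := hcon (1 / ((n : ℝ) + 1)) Nat.one_div_pos_of_nat
    have hx0 : 0 < ‖x‖ := by
      by_contra h0
      have : ‖x‖ = 0 := le_antisymm (not_lt.mp h0) (norm_nonneg x)
      rw [this, mul_zero] at hlt
      exact absurd hlt (not_lt.mpr (norm_nonneg _))
    refine ⟨((‖x‖⁻¹ : ℝ) : ℂ) • x, Submodule.smul_mem _ _ hx, ?_, ?_⟩
    · rw [norm_smul, Complex.norm_real, norm_inv, norm_norm, inv_mul_cancel₀ hx0.ne']
    · rw [map_smul, norm_smul, Complex.norm_real, norm_inv, norm_norm, inv_mul_le_iff₀ hx0,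
        mul_comm]
      exact hlt.le
  choose x hx hnorm hT using hseq
  have hT0 : Tendsto (fun n => T (x n)) atTop (𝓝 0) :=
    squeeze_zero_norm hT tendsto_one_div_add_atTop_nhds_zero_nat
  obtain ⟨C, hC, hsub⟩ := h.image_closedBall_subset_compact (f := (S ∘L T - 1 : E →L[ℂ] E).toLinearMap) 1
  obtain ⟨y, -, φ, hφ, hy⟩ := hC.tendsto_subseq (x := fun n => (S ∘L T - 1) (x n))
    fun n => hsub ⟨x n, by simp [hnorm n], rfl⟩
  -- `x = S T x - (S T - 1) x`: the first term tends to `0` along the sequence and the second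
  -- converges along `φ`. The limit is then a unit vector in both the kernel and its orthogonal
  -- complement.
  have hlim : Tendsto (fun n => x (φ n)) atTop (𝓝 (-y)) := by
    have h1 := (((S.continuous.tendsto 0).comp hT0).comp hφ.tendsto_atTop).sub hy
    simp only [map_zero, zero_sub] at h1
    refine h1.congr fun n => ?_
    simp [Function.comp]
  have hker : -y ∈ T.ker :=
    tendsto_nhds_unique ((T.continuous.tendsto _).comp hlim) (hT0.comp hφ.tendsto_atTop)
  have hperp : -y ∈ T.kerᗮ :=
    (Submodule.isClosed_orthogonal _).mem_of_tendsto hlim (Eventually.of_forall fun n => hx (φ n))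
  have hone : ‖-y‖ = 1 :=
    tendsto_nhds_unique hlim.norm (by simp [hnorm])
  have hzero : -y = 0 := by
    simpa using (Submodule.mem_orthogonal _ _).mp hperp _ hker
  rw [hzero, norm_zero] at hone
  exact zero_ne_one hone

/-- An operator with a left inverse modulo the compact operators has closed range. -/
theorem isClosed_range_of_isCompactOperator_comp_sub_one [CompleteSpace E] (T : E →L[ℂ] F) (S : F →L[ℂ] E)
    (h : IsCompactOperator (S ∘L T - 1 : E →L[ℂ] E)) : IsClosed (T.range : Set F) := by
  obtain ⟨c, hc, hbound⟩ := exists_bound_orthogonal_ker_of_isCompactOperator T S h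
  let R : T.kerᗮ →L[ℂ] F := T ∘L T.kerᗮ.subtypeL
  have hR : AntilipschitzWith (Real.toNNReal c⁻¹) R := by
    refine R.antilipschitz_of_bound fun x => ?_
    rw [Real.coe_toNNReal _ (inv_nonneg.mpr hc.le), ← div_eq_inv_mul, le_div_iff₀' hc]
    exact hbound x x.2
  -- Splitting off the kernel component does not change the image, so the range is already attained
  -- on `T.kerᗮ`, where `T` is bounded below.
  have hrange : (T.range : Set F) = Set.range R := by
    have : CompleteSpace T.ker := T.isClosed_ker.completeSpace_coe
    apply Set.Subset.antisymm
    · rintro _ ⟨x, rfl⟩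
      obtain ⟨a, ha, b, hb, rfl⟩ := T.ker.exists_add_mem_mem_orthogonal x
      have ha : T a = 0 := ha
      exact ⟨⟨b, hb⟩, by simp [R, ha]⟩
    · rintro _ ⟨x, rfl⟩
      exact ⟨x, rfl⟩
  rw [hrange]
  exact hR.isClosed_range R.uniformContinuous

end ClosedRange

/-! ### Sums of closed subspaces and sums of ranges -/

section Sums

variable {H : Type*} [NormedAddCommGroup H] [InnerProductSpace ℂ H]

theorem isCompactOperator_sum {ι X Y : Type*} [NormedAddCommGroup X] [NormedSpace ℂ X]
    [NormedAddCommGroup Y] [NormedSpace ℂ Y] (s : Finset ι) (f : ι → X →L[ℂ] Y)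
    (h : ∀ i ∈ s, IsCompactOperator (f i)) : IsCompactOperator (∑ i ∈ s, f i : X →L[ℂ] Y) :=
  (compactOperator (RingHom.id ℂ) X Y).sum_mem h

/-- A finite sum of closed subspaces is closed if the products of the orthogonal projections onto
distinct summands are compact. -/
theorem isClosed_iSup_of_isCompactOperator_starProjection {ι : Type*} [Fintype ι]
    (K : ι → Submodule ℂ H) [∀ i, CompleteSpace (K i)]
    (h : ∀ i j, i ≠ j → IsCompactOperator ((K i).starProjection * (K j).starProjection)) :
    IsClosed ((⨆ i, K i : Submodule ℂ H) : Set H) := by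
  classical
  -- The `ℓ²` sum makes the domain a Hilbert space, as the closed range criterion requires. `T` adds
  -- the components, and `S`, its adjoint, projects onto each summand.
  let X := PiLp 2 fun i => K i
  let π : ∀ i, X →L[ℂ] K i := fun i => PiLp.proj 2 (fun i => K i) i
  let ι' : ∀ i, K i →L[ℂ] X := fun i =>
    (PiLp.continuousLinearEquiv 2 ℂ fun i => K i).symm.toContinuousLinearMap ∘L
      ContinuousLinearMap.single ℂ (fun i => K i) i
  let T : X →L[ℂ] H := ∑ i, (K i).subtypeL ∘L π i
  let S : H →L[ℂ] X := ∑ i, ι' i ∘L (K i).orthogonalProjectionOnto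
  have hπι : ∀ i j (a : K i), π j (ι' i a) = (Pi.single i a : ∀ i, K i) j := fun _ _ _ => rfl
  have hid : ∀ x : X, x = ∑ i, ι' i (π i x) := by
    intro x
    ext j : 1
    change π j x = π j _
    rw [map_sum, Finset.sum_eq_single j]
    · rw [hπι, Pi.single_eq_same]
    · intro i _ hij
      rw [hπι, Pi.single_eq_of_ne hij.symm]
    · exact fun h => absurd (Finset.mem_univ j) h
  -- Each projection is the identity on its own subspace, so the diagonal blocks of `S T` cancel
  -- against `1` and only the off-diagonal ones remain.
  have hdiff : S ∘L T - 1 = ∑ i, ∑ j ∈ Finset.univ.erase i,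
      ι' i ∘L ((K i).orthogonalProjectionOnto ∘L (K j).subtypeL) ∘L π j := by
    refine ContinuousLinearMap.ext fun x => ?_
    have hx : (S ∘L T - 1 : X →L[ℂ] X) x = S (T x) - ∑ i, ι' i (π i x) := by
      rw [← hid]; rfl
    rw [hx]
    simp only [S, T, _root_.sum_apply, ContinuousLinearMap.comp_apply, map_sum]
    rw [Finset.sum_comm, ← Finset.sum_sub_distrib]
    refine Finset.sum_congr rfl fun i _ => ?_
    rw [Finset.sum_erase_eq_sub (Finset.mem_univ i)]
    simp
  have hcomp : IsCompactOperator (S ∘L T - 1 : X →L[ℂ] X) := by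
    rw [hdiff]
    refine isCompactOperator_sum _ _ fun i _ => isCompactOperator_sum _ _ fun j hj => ?_
    suffices hc : IsCompactOperator ((K i).orthogonalProjectionOnto ∘L (K j).subtypeL) from
      (hc.comp_clm (π j)).clm_comp (ι' i)
    have hij := (h i j (Finset.ne_of_mem_erase hj).symm).comp_clm (K j).subtypeL
    -- Projecting onto `K i` twice is projecting once, and the projection onto `K j` fixes `K j`;
    -- this inserts the compact product into the block.
    have heq : ⇑((K i).orthogonalProjectionOnto ∘L (K j).subtypeL) =
        (K i).orthogonalProjectionOnto ∘ ⇑((K i).starProjection * (K j).starProjection) ∘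
          (K j).subtypeL := by
      ext x
      simp [Submodule.starProjection_eq_self_iff.mpr ((K i).starProjection_apply_mem (x : H))]
    rw [heq]
    exact hij.clm_comp (K i).orthogonalProjectionOnto
  have hrange : T.range = ⨆ i, K i := by
    apply le_antisymm
    · rintro _ ⟨x, rfl⟩
      have : T x = ∑ i, (x i : H) := by simp [T]; rfl
      change T x ∈ _
      rw [this]
      exact Submodule.sum_mem _ fun i _ => Submodule.mem_iSup_of_mem i (x i).2
    · refine iSup_le fun i x hx => ⟨ι' i ⟨x, hx⟩, ?_⟩
      change T _ = x
      simp only [T, _root_.sum_apply, ContinuousLinearMap.comp_apply, hπι]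
      rw [Finset.sum_eq_single i]
      · simp
      · intro j _ hji
        simp [Pi.single_eq_of_ne hji]
      · exact fun h => absurd (Finset.mem_univ i) h
  rw [← hrange]
  exact isClosed_range_of_isCompactOperator_comp_sub_one T S hcomp

/-- Exhibits the sum as the range of one bounded operator, to which the open mapping theorem can be
applied. -/
theorem sumRanges_eq_range {N : ℕ} (A : Fin N → H →L[ℂ] H) :
    sumRanges A = (∑ i, A i ∘L ContinuousLinearMap.proj i : (Fin N → H) →L[ℂ] H).range := by
  apply le_antisymm
  · refine iSup_le fun i => ?_
    rintro _ ⟨x, rfl⟩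
    refine ⟨Pi.single i x, ?_⟩
    change (∑ i, A i ∘L ContinuousLinearMap.proj i : (Fin N → H) →L[ℂ] H) _ = A i x
    simp only [_root_.sum_apply, ContinuousLinearMap.comp_apply, ContinuousLinearMap.proj_apply]
    rw [Finset.sum_eq_single i] <;> simp +contextual
  · rintro _ ⟨x, rfl⟩
    change (∑ i, A i ∘L ContinuousLinearMap.proj i : (Fin N → H) →L[ℂ] H) x ∈ _
    simp only [_root_.sum_apply, ContinuousLinearMap.comp_apply, ContinuousLinearMap.proj_apply]
    exact Submodule.sum_mem _ fun i _ => Submodule.mem_iSup_of_mem i ⟨x i, rfl⟩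

variable [CompleteSpace H]

/-- Orthogonal complements turn sums into intersections, and `Ran(Aᵢ)ᗮ = Ker(Aᵢ*) = Ker(Aᵢ)`. -/
theorem orthogonal_sumRanges {N : ℕ} (A : Fin N → H →L[ℂ] H) (hA : ∀ i, IsSelfAdjoint (A i)) :
    (sumRanges A)ᗮ = ⨅ i, (A i).ker := by
  rw [sumRanges, ← Submodule.iInf_orthogonal]
  refine iInf_congr fun i => ?_
  rw [ContinuousLinearMap.orthogonal_range, (hA i).adjoint_eq]

theorem sumRanges_eq_orthogonal {N : ℕ} (A : Fin N → H →L[ℂ] H) (hA : ∀ i, IsSelfAdjoint (A i))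
    (h : IsClosed (sumRanges A : Set H)) : sumRanges A = (⨅ i, (A i).ker)ᗮ := by
  have : CompleteSpace (sumRanges A) := h.completeSpace_coe
  rw [← orthogonal_sumRanges A hA, Submodule.orthogonal_orthogonal]

end Sums

/-! ### Spectral projections of a single operator -/

section SpectralMeasure

variable {H : Type*} [NormedAddCommGroup H] [InnerProductSpace ℂ H] [CompleteSpace H]

theorem ProjectionValuedMeasure.diagMeasure_real (E : ProjectionValuedMeasure H) (x : H)
    {S : Set ℝ} (hS : MeasurableSet S) : (E.diagMeasure x).real S = ‖E.proj S x‖ ^ 2 := by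
  rw [measureReal_def, E.diagMeasure_apply x hS, ENNReal.toReal_ofReal (sq_nonneg _)]

theorem IsStarProjection.mem_range_iff {P : H →L[ℂ] H} (hP : IsStarProjection P) {x : H} :
    x ∈ P.range ↔ P x = x := by
  constructor
  · rintro ⟨y, rfl⟩
    exact congrArg (fun T : H →L[ℂ] H => T y) hP.isIdempotentElem.eq
  · exact fun h => ⟨x, h⟩

theorem IsStarProjection.isClosed_range {P : H →L[ℂ] H} (hP : IsStarProjection P) :
    IsClosed (P.range : Set H) := by
  have h : (P.range : Set H) = {x | P x = x} := Set.ext fun x => hP.mem_range_iff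
  rw [h]
  exact isClosed_eq P.continuous continuous_id

/-- Since `⟪x, P x⟫ = ‖P x‖²`, expanding gives `‖x - P x‖² = ‖x‖² - ‖P x‖²`. This lets membership in
the range be read off from the scalar measures. -/
theorem IsStarProjection.apply_eq_self_iff_norm_sq {P : H →L[ℂ] H} (hP : IsStarProjection P)
    (x : H) : P x = x ↔ ‖P x‖ ^ 2 = ‖x‖ ^ 2 := by
  refine ⟨fun h => by rw [h], fun h => ?_⟩
  have h1 := hP.inner_self_apply x
  have h2 := @norm_sub_sq ℂ H _ _ _ x (P x)
  rw [h1] at h2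
  have h3 : ‖x - P x‖ ^ 2 = 0 := by
    rw [h2, h, RCLike.re_eq_complex_re, Complex.ofReal_re]
    ring
  exact (sub_eq_zero.mp (by simpa using h3)).symm

/-- The range of `E(S)` consists of the vectors whose scalar measure is carried by `S`. -/
theorem ProjectionValuedMeasure.mem_range_proj_iff (E : ProjectionValuedMeasure H) (x : H)
    {S : Set ℝ} (hS : MeasurableSet S) :
    x ∈ (E.proj S).range ↔ ∀ᵐ t ∂E.diagMeasure x, t ∈ S := by
  have hP := E.isStarProjection S hS
  rw [hP.mem_range_iff, hP.apply_eq_self_iff_norm_sq, ← E.diagMeasure_real x hS]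
  have huniv : (E.diagMeasure x).real Set.univ = ‖x‖ ^ 2 := by
    rw [E.diagMeasure_real x MeasurableSet.univ, E.proj_univ]; rfl
  rw [← huniv, ae_iff, ← measureReal_eq_zero_iff]
  have h := measureReal_compl (μ := E.diagMeasure x) hS
  change _ ↔ (E.diagMeasure x).real Sᶜ = 0
  rw [h, sub_eq_zero, eq_comm]

theorem ProjectionValuedMeasure.range_proj_mono (E : ProjectionValuedMeasure H) {S S' : Set ℝ}
    (hS : MeasurableSet S) (hS' : MeasurableSet S') (h : S ⊆ S') :
    (E.proj S).range ≤ (E.proj S').range := by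
  intro x hx
  rw [E.mem_range_proj_iff x hS] at hx
  rw [E.mem_range_proj_iff x hS']
  exact hx.mono fun t ht => h ht

theorem IsSpectralMeasure.norm_apply_sq {A : H →L[ℂ] H} {E : ProjectionValuedMeasure H}
    (hE : IsSpectralMeasure A E) (hA : IsSelfAdjoint A) (x : H) :
    ‖A x‖ ^ 2 = ∫ t, t ^ 2 ∂E.diagMeasure x := by
  have h := norm_cfc_sq A (E.diagMeasure x) x (fun f hf => hE f hf x) hA id continuous_id
  rwa [cfc_id ℝ A] at h

theorem IsSpectralMeasure.norm_apply_le {A : H →L[ℂ] H} {E : ProjectionValuedMeasure H}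
    (hE : IsSpectralMeasure A E) (hA : IsSelfAdjoint A) {ε : ℝ} (hε : 0 ≤ ε) {x : H}
    (hx : x ∈ (E.proj (Set.Icc (-ε) ε)).range) : ‖A x‖ ≤ ε * ‖x‖ := by
  rw [E.mem_range_proj_iff x measurableSet_Icc] at hx
  have huniv : (E.diagMeasure x).real Set.univ = ‖x‖ ^ 2 := by
    rw [E.diagMeasure_real x MeasurableSet.univ, E.proj_univ]; rfl
  refine le_of_sq_le_sq ?_ (by positivity)
  rw [hE.norm_apply_sq hA, mul_pow, ← huniv]
  have hle : ∫ t, t ^ 2 ∂E.diagMeasure x ≤ ∫ _t, ε ^ 2 ∂E.diagMeasure x := by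
    -- Only the constant has to be integrable here; integrability of `t ^ 2` is not needed.
    refine integral_mono_of_nonneg (Eventually.of_forall fun t => sq_nonneg t)
      (integrable_const _) (hx.mono fun t ht => ?_)
    exact sq_le_sq' ht.1 ht.2
  rw [integral_const, smul_eq_mul, mul_comm] at hle
  exact hle

/-- `E_A({0})` is the projection onto the kernel of `A`. -/
theorem IsSpectralMeasure.range_proj_zero {A : H →L[ℂ] H} {E : ProjectionValuedMeasure H}
    (hE : IsSpectralMeasure A E) (hA : IsSelfAdjoint A) :
    (E.proj (Set.Icc (-0) 0)).range = A.ker := by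
  ext x
  constructor
  · intro hx
    have := hE.norm_apply_le hA le_rfl hx
    rw [zero_mul] at this
    exact norm_le_zero_iff.mp this
  · intro hx
    have hx : A x = 0 := hx
    -- A damping factor: `h t * t` is bounded, hence its square is integrable, and it vanishes only
    -- at `0`. Zero integral then forces the measure onto `{0}`.
    let h : ℝ → ℝ := fun t => 1 / (1 + t ^ 2)
    have hpos : ∀ t : ℝ, 0 < 1 + t ^ 2 := fun t => by positivity
    have hh : Continuous h := continuous_const.div (by fun_prop) fun t => (hpos t).ne'
    have hzero : cfc (fun t => h t * t) A x = 0 := by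
      rw [cfc_mul h (fun t => t) A hh.continuousOn continuousOn_id, cfc_id' ℝ A]
      change cfc h A (A x) = 0
      rw [hx, map_zero]
    have hint := norm_cfc_sq A (E.diagMeasure x) x (fun f hf => hE f hf x) hA
      (fun t => h t * t) (hh.mul continuous_id)
    rw [hzero, norm_zero, zero_pow two_ne_zero, eq_comm, integral_eq_zero_iff_of_nonneg] at hint
    · rw [E.mem_range_proj_iff x measurableSet_Icc]
      filter_upwards [hint] with t ht
      have ht : (1 / (1 + t ^ 2) * t) ^ 2 = 0 := ht
      have h0 : t = 0 := by simpa [(hpos t).ne'] using ht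
      simp [h0]
    · exact fun t => sq_nonneg _
    · refine Integrable.of_bound ((hh.mul continuous_id).pow 2).aestronglyMeasurable 1
        (Eventually.of_forall fun t => ?_)
      rw [norm_pow]
      refine pow_le_one₀ (norm_nonneg _) ?_
      change |1 / (1 + t ^ 2) * t| ≤ 1
      rw [one_div_mul_eq_div, abs_div, abs_of_pos (hpos t), div_le_one (hpos t), ← sq_abs t]
      nlinarith [sq_nonneg (|t| - 1), abs_nonneg t]

/-- The spectral projection of `A` off a neighbourhood of `0` is right divisible from `A`. -/
theorem IsSpectralMeasure.exists_one_sub_proj_eq_mul {A : H →L[ℂ] H}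
    {E : ProjectionValuedMeasure H} (hE : IsSpectralMeasure A E) (hA : IsSelfAdjoint A)
    {ε : ℝ} (hε : 0 < ε) : ∃ C : H →L[ℂ] H, 1 - E.proj (Set.Icc (-ε) ε) = A * C := by
  have hpos : ∀ t : ℝ, 0 < max (t ^ 2) (ε ^ 2) := fun t => lt_max_of_lt_right (by positivity)
  -- A continuous function on the whole line that equals `1 / t` for `|t| ≥ ε`, so `1 - t * h t`
  -- vanishes there.
  let h : ℝ → ℝ := fun t => t / max (t ^ 2) (ε ^ 2)
  have hh : Continuous h := continuous_id.div (by fun_prop) fun t => (hpos t).ne'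
  have hP := E.isStarProjection _ (measurableSet_Icc (a := -ε) (b := ε))
  have hcfc : cfc (fun t => 1 - t * h t) A = 1 - A * cfc h A := by
    rw [cfc_sub (fun _ => (1 : ℝ)) (fun t => t * h t) A continuousOn_const (by fun_prop),
      cfc_mul (fun t => t) h A continuousOn_id hh.continuousOn, cfc_id' ℝ A, cfc_const_one ℝ A]
  refine ⟨cfc h A * (1 - E.proj (Set.Icc (-ε) ε)), ?_⟩
  ext x
  -- The scalar measure of `y` is carried by the complement of `[-ε, ε]`, where `1 - t * h t = 0`;
  -- hence `(1 - A h(A)) y = 0`.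
  set y := (1 - E.proj (Set.Icc (-ε) ε)) x with hy
  have hEy : E.proj (Set.Icc (-ε) ε) y = 0 := by
    have := congrArg (fun T : H →L[ℂ] H => T x) hP.isIdempotentElem.eq
    change E.proj _ (E.proj _ x) = E.proj _ x at this
    simp [hy, this]
  have hae : ∀ᵐ t ∂E.diagMeasure y, t ∉ Set.Icc (-ε) ε := by
    rw [ae_iff]
    simp only [not_not, Set.ofPred_mem_eq]
    rw [E.diagMeasure_apply y measurableSet_Icc, hEy]
    simp
  have hnorm := norm_cfc_sq A (E.diagMeasure y) y (fun f hf => hE f hf y) hA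
    (fun t => 1 - t * h t) (by fun_prop)
  have hzero : ∫ t, (1 - t * h t) ^ 2 ∂E.diagMeasure y = 0 := by
    rw [integral_eq_zero_of_ae]
    filter_upwards [hae] with t ht
    have hlt : ε ^ 2 ≤ t ^ 2 := by
      rw [sq_le_sq, abs_of_pos hε]
      by_contra hcon
      exact ht (abs_le.mp (not_le.mp hcon).le)
    have ht0 : t ^ 2 ≠ 0 := ne_of_gt (lt_of_lt_of_le (by positivity) hlt)
    have : t * h t = 1 := by
      simp only [h, max_eq_left hlt]
      rw [mul_div_assoc', ← pow_two, div_self ht0]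
    simp [this]
  rw [hzero, hcfc] at hnorm
  have : y - A (cfc h A y) = 0 := by simpa using hnorm
  exact sub_eq_zero.mp this

end SpectralMeasure

/-! ### Joint spectral subspaces and the sum of the ranges -/

section SpectralSubspace

variable {H : Type*} [NormedAddCommGroup H] [InnerProductSpace ℂ H] [CompleteSpace H]
  {N : ℕ} (A : Fin N → H →L[ℂ] H) (hA : ∀ i, IsSelfAdjoint (A i))

theorem spectralSubspace_zero : spectralSubspace A hA 0 = ⨅ i, (A i).ker :=
  iInf_congr fun i => (isSpectralMeasure_spectralMeasure (A i) (hA i)).range_proj_zero (hA i)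

theorem spectralSubspace_mono {ε δ : ℝ} (h : ε ≤ δ) :
    spectralSubspace A hA ε ≤ spectralSubspace A hA δ :=
  iInf_mono fun _ => ProjectionValuedMeasure.range_proj_mono _ measurableSet_Icc measurableSet_Icc
    (Set.Icc_subset_Icc (neg_le_neg h) h)

theorem isClosed_spectralSubspace (ε : ℝ) : IsClosed (spectralSubspace A hA ε : Set H) := by
  rw [spectralSubspace, Submodule.coe_iInf]
  refine isClosed_iInter fun i => ?_
  exact ((spectralMeasure (A i) (hA i)).isStarProjection _ measurableSet_Icc).isClosed_range

/-- A vector of `H_ε ∩ H₀ᗮ` is a controlled combination of values of the `Aᵢ`, yet every `Aᵢ` nearly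
annihilates it; pairing it with itself makes these incompatible for small `ε`. -/
theorem spectralSubspace_inf_orthogonal_eq_bot (h : IsClosed (sumRanges A : Set H)) :
    ∃ ε : ℝ, 0 < ε ∧ spectralSubspace A hA ε ⊓ (spectralSubspace A hA 0)ᗮ = ⊥ := by
  let T : (Fin N → H) →L[ℂ] H := ∑ i, A i ∘L ContinuousLinearMap.proj i
  have hT : ∀ y, T y = ∑ i, A i (y i) := fun y => by simp [T]
  have hTR : ∀ y, T y ∈ sumRanges A := fun y => by
    rw [sumRanges_eq_range]; exact ⟨y, rfl⟩
  have : CompleteSpace (sumRanges A) := h.completeSpace_coe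
  -- Restricting the codomain gives a surjection between Banach spaces; this is where closedness
  -- enters.
  let T' : (Fin N → H) →L[ℂ] sumRanges A := T.codRestrict _ hTR
  have hsurj : Function.Surjective T' := by
    rintro ⟨x, hx⟩
    rw [sumRanges_eq_range] at hx
    obtain ⟨y, hy⟩ := hx
    exact ⟨y, Subtype.ext hy⟩
  obtain ⟨C, hC, hbound⟩ := T'.exists_preimage_norm_le hsurj
  -- Chosen so that `N * C * ε < 1`.
  let ε : ℝ := 1 / (N * C + 1)
  have hden : 0 < N * C + 1 := by positivity
  have hε : 0 < ε := by positivity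
  refine ⟨ε, hε, ?_⟩
  rw [Submodule.eq_bot_iff]
  rintro x ⟨hxε, hx0⟩
  rw [SetLike.mem_coe, spectralSubspace_zero, ← sumRanges_eq_orthogonal A hA h] at hx0
  obtain ⟨y, hy, hyC⟩ := hbound ⟨x, hx0⟩
  have hxy : x = ∑ i, A i (y i) := by rw [← hT]; exact (congrArg Subtype.val hy).symm
  have hAx : ∀ i, ‖A i x‖ ≤ ε * ‖x‖ := fun i =>
    (isSpectralMeasure_spectralMeasure (A i) (hA i)).norm_apply_le (hA i) hε.le
      ((Submodule.mem_iInf _).mp hxε i)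
  have hinner : ⟪x, x⟫_ℂ = ∑ i, ⟪A i x, y i⟫_ℂ := by
    -- Only the second argument is to be expanded: both copies of `x` are replaced, and the first is
    -- folded back.
    conv_lhs => rw [hxy, inner_sum, ← hxy]
    exact Finset.sum_congr rfl fun i _ =>
      (ContinuousLinearMap.isSelfAdjoint_iff_isSymmetric.mp (hA i) x (y i)).symm
  have hle : ‖x‖ ^ 2 ≤ N * ((ε * ‖x‖) * (C * ‖x‖)) := by
    have h1 : ‖x‖ ^ 2 = ‖⟪x, x⟫_ℂ‖ := by simp [inner_self_eq_norm_sq_to_K]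
    rw [h1, hinner]
    refine (norm_sum_le _ _).trans ?_
    have : ∀ i ∈ Finset.univ, ‖⟪A i x, y i⟫_ℂ‖ ≤ (ε * ‖x‖) * (C * ‖x‖) := fun i _ =>
      (norm_inner_le_norm _ _).trans
        (mul_le_mul (hAx i) ((norm_le_pi_norm y i).trans hyC) (norm_nonneg _) (by positivity))
    simpa using Finset.sum_le_card_nsmul _ _ _ this
  have hsmall : N * C * ε < 1 := by
    simp only [ε]
    rw [mul_one_div, div_lt_one hden]
    linarith
  by_contra hne
  have hxpos : 0 < ‖x‖ ^ 2 := by positivity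
  nlinarith

theorem spectralSubspace_sup_inf_orthogonal {ε : ℝ} (hε : 0 ≤ ε) :
    spectralSubspace A hA 0 ⊔ (spectralSubspace A hA 0)ᗮ ⊓ spectralSubspace A hA ε =
      spectralSubspace A hA ε := by
  have : CompleteSpace (spectralSubspace A hA 0) := by
    exact (isClosed_spectralSubspace A hA 0).completeSpace_coe
  exact Submodule.sup_orthogonal_inf_of_hasOrthogonalProjection (spectralSubspace_mono A hA hε)

/-- For `ε > 0`, the complement of the joint spectral subspace lies in the sum of the ranges. -/
theorem orthogonal_spectralSubspace_le_sumRanges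
    (hcomp : ∀ i j, i ≠ j → IsCompactOperator (A i * A j)) {ε : ℝ} (hε : 0 < ε) :
    (spectralSubspace A hA ε)ᗮ ≤ sumRanges A := by
  let P : Fin N → H →L[ℂ] H := fun i =>
    1 - (spectralMeasure (A i) (hA i)).proj (Set.Icc (-ε) ε)
  have hproj : ∀ i, IsStarProjection ((spectralMeasure (A i) (hA i)).proj (Set.Icc (-ε) ε)) :=
    fun i => (spectralMeasure (A i) (hA i)).isStarProjection _ measurableSet_Icc
  have hP : ∀ i, IsStarProjection (P i) := fun i => (hproj i).one_sub
  choose C hC using fun i =>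
    (isSpectralMeasure_spectralMeasure (A i) (hA i)).exists_one_sub_proj_eq_mul (hA i) hε
  have hPC : ∀ i, P i = A i * C i := hC
  -- Taking adjoints moves `A i` to the right, so that `A i * A j` appears in the middle of `P i * P
  -- j`.
  have hPC' : ∀ i, P i = star (C i) * A i := fun i => by
    rw [← (hP i).isSelfAdjoint.star_eq, hPC, star_mul, (hA i).star_eq]
  have hcomplete : ∀ i, CompleteSpace (P i).range := fun i =>
    (hP i).isClosed_range.completeSpace_coe
  have hstar : ∀ i, (P i).range.starProjection = P i := fun i =>
    (isStarProjection_iff_eq_starProjection_range.mp (hP i)).choose_spec.symm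
  have hclosed : IsClosed ((⨆ i, (P i).range : Submodule ℂ H) : Set H) := by
    refine isClosed_iSup_of_isCompactOperator_starProjection _ fun i j hij => ?_
    rw [hstar, hstar, hPC' i, hPC j]
    exact ((hcomp i j hij).comp_clm (C j)).clm_comp (star (C i))
  have hcomplete' : CompleteSpace (⨆ i, (P i).range : Submodule ℂ H) := hclosed.completeSpace_coe
  -- The complement of `Ran(Pᵢ)` is `Ker(Pᵢ)`, the set of vectors fixed by `E_{Aᵢ}([-ε, ε])`.
  have hperp : spectralSubspace A hA ε = (⨆ i, (P i).range)ᗮ := by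
    rw [← Submodule.iInf_orthogonal]
    refine iInf_congr fun i => ?_
    rw [ContinuousLinearMap.orthogonal_range, (hP i).isSelfAdjoint.adjoint_eq]
    ext x
    rw [(hproj i).mem_range_iff]
    exact (eq_comm.trans sub_eq_zero.symm)
  rw [hperp, Submodule.orthogonal_orthogonal]
  refine iSup_mono fun i => ?_
  rw [hPC]
  rintro _ ⟨x, rfl⟩
  exact ⟨C i x, rfl⟩

/-- The sum of the ranges lies between `H_εᗮ` and `H₀ᗮ = H_εᗮ ⊕ V`, so it exceeds the closed
subspace `H_εᗮ` only by a subspace of the finite-dimensional `V`. -/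
theorem isClosed_sumRanges_of_finiteDimensional
    (hcomp : ∀ i j, i ≠ j → IsCompactOperator (A i * A j)) {ε : ℝ} (hε : 0 < ε)
    [FiniteDimensional ℂ ↥(spectralSubspace A hA ε ⊓ (spectralSubspace A hA 0)ᗮ)] :
    IsClosed (sumRanges A : Set H) := by
  set V := spectralSubspace A hA ε ⊓ (spectralSubspace A hA 0)ᗮ with hV
  have hM := orthogonal_spectralSubspace_le_sumRanges A hA hcomp hε
  have hR : sumRanges A ≤ (spectralSubspace A hA 0)ᗮ := by
    rw [spectralSubspace_zero, ← orthogonal_sumRanges A hA]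
    exact Submodule.le_orthogonal_orthogonal _
  have hcomplete : CompleteSpace (spectralSubspace A hA ε) := (isClosed_spectralSubspace A hA ε).completeSpace_coe
  have hsup : (spectralSubspace A hA ε)ᗮ ⊔ V = (spectralSubspace A hA 0)ᗮ := by
    have := Submodule.sup_orthogonal_inf_of_hasOrthogonalProjection
      (Submodule.orthogonal_le (spectralSubspace_mono A hA hε.le))
    rwa [Submodule.orthogonal_orthogonal] at this
  -- The modular law, applicable because `H_εᗮ ≤ sumRanges A`.
  have hmod : sumRanges A = (spectralSubspace A hA ε)ᗮ ⊔ V ⊓ sumRanges A := by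
    rw [← sup_inf_assoc_of_le V hM, hsup, inf_eq_right.mpr hR]
  have : FiniteDimensional ℂ ↥(V ⊓ sumRanges A) :=
    Submodule.finiteDimensional_of_le inf_le_left
  rw [hmod]
  exact Submodule.isClosed_sup_finiteDimensional _ _ (Submodule.isClosed_orthogonal _)

end SpectralSubspace

/-! ### The main theorem -/

theorem theorem1p1 {H : Type*} [NormedAddCommGroup H] [InnerProductSpace ℂ H] [CompleteSpace H]
    {N : ℕ} (hN : 2 ≤ N) (A : Fin N → H →L[ℂ] H) (hA : ∀ i, IsSelfAdjoint (A i))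
    (hcomp : ∀ i j, i ≠ j → IsCompactOperator (A i * A j)) :
    spectralSubspace A hA 0 = ⨅ i, (A i).ker ∧
    (IsClosed (sumRanges A : Set H) ↔
      ∃ ε : ℝ, 0 < ε ∧ spectralSubspace A hA ε = spectralSubspace A hA 0) ∧
    ((∃ ε : ℝ, 0 < ε ∧
        FiniteDimensional ℂ ↥(spectralSubspace A hA ε ⊓ (spectralSubspace A hA 0)ᗮ)) →
      IsClosed (sumRanges A : Set H)) ∧
    (IsClosed (sumRanges A : Set H) → sumRanges A = (spectralSubspace A hA 0)ᗮ) := by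
  refine ⟨spectralSubspace_zero A hA, ⟨fun h => ?_, ?_⟩, ?_, fun h => ?_⟩
  · obtain ⟨ε, hε, hbot⟩ := spectralSubspace_inf_orthogonal_eq_bot A hA h
    refine ⟨ε, hε, ?_⟩
    -- In `H_ε = H₀ ⊕ (H₀ᗮ ∩ H_ε)` the second summand is zero.
    rw [← spectralSubspace_sup_inf_orthogonal A hA hε.le, inf_comm, hbot, sup_bot_eq]
  · rintro ⟨ε, hε, heq⟩
    have : FiniteDimensional ℂ ↥(spectralSubspace A hA ε ⊓ (spectralSubspace A hA 0)ᗮ) := by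
      rw [heq, Submodule.inf_orthogonal_eq_bot]
      infer_instance
    exact isClosed_sumRanges_of_finiteDimensional A hA hcomp hε
  · rintro ⟨ε, hε, hfin⟩
    exact isClosed_sumRanges_of_finiteDimensional A hA hcomp hε
  · rw [spectralSubspace_zero]
    exact sumRanges_eq_orthogonal A hA h
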